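/- Let $p$ be a prime. For a positive integer $a$ put $A_a=\begin{pmatrix}0&1\\1&a\end{pmatrix}$, and for a finite word $u=a_1\ldots a_n$ of positive integers put $A_u=A_{a_1}\cdots A_{a_n}$. For $N\in\mathbb N$ let $\mathbb A_N=\{1,\dots,N\}$. On pairs $(w,\mathbf q)$ consisting of an infinite word $w=a_1a_2\ldots$ of positive integers and a point $\mathbf q$ of the projective line $\mathbf P^1_{\mathbb Q_p}$, define $\mathrm T(w,\mathbf q)=(a_2a_3\ldots,\,A_{a_1}\mathbf q)$. For $\epsilon>0$ let $\mathbf{PBad}_\epsilon$ be the set of $\mathbf q=(q_1,q_2)\in\mathbf P^1_{\mathbb Q_p}$ such that $$\frac{|aq_1+bq_2|_p}{\max\{|q_1|_p,|q_2|_p\}}\ \ge\ \frac{\epsilon}{\max\{|a|,|b|\}^{2}}\qquad\text{for all }(a,b)\in\mathbb Z^2\setminus\{(0,0)\}.$$ Let $\mathbf{LMad}$ be the set of pairs $(w,\mathbf x_p)$ for which there is $\epsilon>0$ such that $\mathrm T^n(w,\mathbf x_p)\in\mathbb A_{N_\epsilon}^{\mathbb N}\times\mathbf{PBad}_\epsilon$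 for all $n\ge 0$, where $N_\epsilon=\lfloor\epsilon^{-1}\rfloor+1$. Let $N\in\mathbb N$, let $w=a_1a_2\ldots\in\mathbb A_N^{\mathbb N}$ be a (purely) periodic infinite word, let $l\ge 1$ be the length of its minimal period, and let $w_l=a_1\ldots a_l$. Then for every $\mathbf x_p\in\mathbf P^1_{\mathbb Q_p}$, $(w,\mathbf x_p)\in\mathbf{LMad}$ if and only if $\mathbf x_p$ is (the class of) an eigenvector of $A_{w_l}^T$ in $\mathbb Q_p^2$. Moreover, the set $\mathbf{LMad}$ is infinite. -/

import Mathlib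

open scoped LinearAlgebra.Projectivization

noncomputable section

namespace PLC

/-- The projective line over the field of `p`-adic numbers. -/
abbrev P1 (p : ℕ) [Fact p.Prime] : Type := ℙ ℚ_[p] (Fin 2 → ℚ_[p])

/-- The matrix `A_a` attached to a letter `a`. -/
def letterMatrix (a : ℕ) : Matrix (Fin 2) (Fin 2) ℤ := !![0, 1; 1, (a : ℤ)]

theorem det_letterMatrix (a : ℕ) : (letterMatrix a).det = -1 := by
  simp [letterMatrix, Matrix.det_fin_two]

/-- The matrix `A_u = A_{a_1} ⋯ A_{a_l}` of a finite word `u = a_1 … a_l`. -/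
def wordMatrix (u : List ℕ) : Matrix (Fin 2) (Fin 2) ℤ := (u.map letterMatrix).prod

/-- The prefix of length `l` of an infinite word (the first letter of `w` is `w 0`). -/
def wordPrefix (w : ℕ → ℕ) (l : ℕ) : List ℕ := (List.range l).map w

/-- The infinite words over the alphabet `{1, …, N}`. -/
def words (N : ℕ) : Set (ℕ → ℕ) := {w | ∀ n, w n ∈ Set.Icc 1 N}

/-- An integer matrix, as a linear endomorphism of the plane of `p`-adic column vectors. -/
def padicLin (p : ℕ) [Fact p.Prime] (M : Matrix (Fin 2) (Fin 2) ℤ) :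
    (Fin 2 → ℚ_[p]) →ₗ[ℚ_[p]] (Fin 2 → ℚ_[p]) :=
  Matrix.toLin' (M.map (Int.castRingHom ℚ_[p]))

theorem padicLin_letterMatrix_injective (p : ℕ) [Fact p.Prime] (a : ℕ) :
    Function.Injective (padicLin p (letterMatrix a)) := by
  have h : IsUnit ((letterMatrix a).map (Int.castRingHom ℚ_[p])) := by
    rw [Matrix.isUnit_iff_isUnit_det, ← RingHom.mapMatrix_apply, ← RingHom.map_det,
      det_letterMatrix]
    simp
  intro x y hxy
  exact Matrix.mulVec_injective_of_isUnit h (by simpa [padicLin] using hxy)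

/-- The extended shift `T (w, q) = (T w, A_{a_1} q)`, where `a_1` is the first letter of `w`. -/
def T (p : ℕ) [Fact p.Prime] (x : (ℕ → ℕ) × P1 p) : (ℕ → ℕ) × P1 p :=
  (fun n => x.1 (n + 1),
    Projectivization.map (padicLin p (letterMatrix (x.1 0)))
      (padicLin_letterMatrix_injective p (x.1 0)) x.2)

/-- The points of the projective line which are `p`-adically badly approximable with constant `ε`.
The condition does not depend on the homogeneous coordinates `q = (q_1, q_2)`. With `0⁻¹ = ∞`,
`min {|a|⁻², |b|⁻²} = 1 / max {|a|, |b|} ^ 2` and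
`min {|q_1⁻¹|_p, |q_2⁻¹|_p} = 1 / max {|q_1|_p, |q_2|_p}`; both maxima are positive here. -/
def PBadEps (p : ℕ) [Fact p.Prime] (ε : ℝ) : Set (P1 p) :=
  {x | ∀ (q : Fin 2 → ℚ_[p]) (hq : q ≠ 0), Projectivization.mk ℚ_[p] q hq = x →
    ∀ a b : ℤ, (a, b) ≠ (0, 0) →
      ε / (max |(a : ℝ)| |(b : ℝ)|) ^ 2 ≤
        ‖(a : ℚ_[p]) * q 0 + (b : ℚ_[p]) * q 1‖ / max ‖q 0‖ ‖q 1‖}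

/-- The pairs all of whose images under the iterates of `T` lie in
`{1, …, N}^ℕ × PBad_ε`, with `N = [1/ε] + 1` (meant for `ε > 0`). -/
def LMadEps (p : ℕ) [Fact p.Prime] (ε : ℝ) : Set ((ℕ → ℕ) × P1 p) :=
  {x | ∀ n : ℕ, (T p)^[n] x ∈ words (⌊ε⁻¹⌋₊ + 1) ×ˢ PBadEps p ε}

/-- The set `LMad`: the union of the sets `LMad_ε` over all `ε > 0`. -/
def LMad (p : ℕ) [Fact p.Prime] : Set ((ℕ → ℕ) × P1 p) :=
  {x | ∃ ε : ℝ, 0 < ε ∧ x ∈ LMadEps p ε}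

/-- The point `x` of the projective line is (the class of) an eigenvector of `M`. -/
def IsEigenpoint (p : ℕ) [Fact p.Prime] (M : Matrix (Fin 2) (Fin 2) ℤ) (x : P1 p) : Prop :=
  ∃ (μ : ℚ_[p]) (v : Fin 2 → ℚ_[p]) (hv : Module.End.HasEigenvector (padicLin p M) μ v),
    x = Projectivization.mk ℚ_[p] v hv.2

end PLC

end

open scoped LinearAlgebra.Projectivization

noncomputable section

namespace PLC

open Matrix

/-! Let `M` be the transposed period matrix, so that a full period of `T` acts on the point by `M`.
If `q` is an eigenvector and `v = (a, b)`, then the integer `Q = det [v; v M]` times each coordinate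
of `q` equals `v · q` times a bounded factor. The form `Q` is anisotropic over the rationals because
`tr² - 4 det` is not a square, so `|Q|_p ≥ 1 / |Q|`, which is at least a constant over `max(|a|,
|b|)²`. The orbit of `T` is finite, hence one `ε` serves for all of it
(`exists_mem_PBadEps_of_isEigenpoint`). If `q` is not an eigenvector, the `p`-adic closure of its
orbit under powers of `M` contains a neighbourhood of `q` in the projective line, hence the zero of
some integral form. That fixed form takes arbitrarily small values on the orbit, against the bound
with `ε` (`exists_pow_norm_le`, `not_forall_mem_PBadEps`). Infinitude comes from constant words
whose eigenvectors Hensel's lemma provides. -/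

/-! ### Powers of an integer matrix modulo powers of `p` -/

/-- Powers of a two-by-two matrix are combinations of it and the identity, with coefficients that
depend only on the trace and the determinant. -/
theorem exists_pow_eq_smul_add_smul {R : Type*} [CommRing R] (t d : R) (m : ℕ) :
    ∃ u α : R, ∀ M : Matrix (Fin 2) (Fin 2) R, M.trace = t → M.det = d →
      M ^ m = u • M + α • (1 : Matrix (Fin 2) (Fin 2) R) := by
  induction m with
  | zero => exact ⟨0, 1, fun M _ _ => by simp⟩
  | succ m ih =>
    obtain ⟨u, α, h⟩ := ih
    refine ⟨u * t + α, -(u * d), fun M ht hd => ?_⟩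
    rw [pow_succ, h M ht hd, ← ht, ← hd]
    ext i j
    fin_cases i <;> fin_cases j <;>
      simp [Matrix.mul_apply, Fin.sum_univ_two, Matrix.trace_fin_two, Matrix.det_fin_two] <;> ring

theorem sq_eq_trace_smul_sub_det_smul {R : Type*} [CommRing R] (M : Matrix (Fin 2) (Fin 2) R) :
    M * M = M.trace • M - M.det • (1 : Matrix (Fin 2) (Fin 2) R) := by
  ext i j
  fin_cases i <;> fin_cases j <;>
    simp [Matrix.mul_apply, Fin.sum_univ_two, Matrix.trace_fin_two, Matrix.det_fin_two] <;> ring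

/-- Some power of `M` is `u M + α` with `u ≡ 0` and `α ≡ 1` modulo `n`. -/
theorem exists_pow_eq_dvd {M : Matrix (Fin 2) (Fin 2) ℤ} (hd : IsUnit M.det)
    {n : ℕ} (hn : 0 < n) :
    ∃ m : ℕ, 0 < m ∧ ∃ u α : ℤ, M ^ m = u • M + α • (1 : Matrix (Fin 2) (Fin 2) ℤ) ∧
      (n : ℤ) ∣ u ∧ (n : ℤ) ∣ α - 1 := by
  have : NeZero n := ⟨hn.ne'⟩
  -- The companion matrix has the same `u` and `α`, and displays them as entries of its first row;
  -- in `M` itself the off-diagonal entries may share factors with `n`.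
  let C : Matrix (Fin 2) (Fin 2) ℤ := !![0, 1; -M.det, M.trace]
  have hCt : C.trace = M.trace := by simp [C, Matrix.trace_fin_two]
  have hCd : C.det = M.det := by simp [C, Matrix.det_fin_two]
  let f : Matrix (Fin 2) (Fin 2) ℤ →+* Matrix (Fin 2) (Fin 2) (ZMod n) :=
    (Int.castRingHom (ZMod n)).mapMatrix
  have hu : IsUnit (f C) := by
    apply IsUnit.map
    rw [Matrix.isUnit_iff_isUnit_det, hCd]
    exact hd
  obtain ⟨g, hg⟩ := hu
  obtain ⟨m, hm, hgm⟩ := isOfFinOrder_iff_pow_eq_one.1 (isOfFinOrder_of_finite g)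
  obtain ⟨u, α, h⟩ := exists_pow_eq_smul_add_smul M.trace M.det m
  refine ⟨m, hm, u, α, h M rfl rfl, ?_⟩
  have hf : f (u • C + α • (1 : Matrix (Fin 2) (Fin 2) ℤ)) = 1 := by
    rw [← h C hCt hCd, map_pow, ← hg, ← Units.val_pow_eq_pow_val, hgm, Units.val_one]
  have e01 : (u • C + α • (1 : Matrix (Fin 2) (Fin 2) ℤ)) 0 1 = u := by
    rw [Matrix.add_apply, Matrix.smul_apply, Matrix.smul_apply]
    simp [C]
  have e00 : (u • C + α • (1 : Matrix (Fin 2) (Fin 2) ℤ)) 0 0 = α := by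
    rw [Matrix.add_apply, Matrix.smul_apply, Matrix.smul_apply]
    simp [C]
  have h01 : (((u • C + α • (1 : Matrix (Fin 2) (Fin 2) ℤ)) 0 1 : ℤ) : ZMod n) = 0 :=
    congrFun (congrFun hf 0) 1
  have h00 : (((u • C + α • (1 : Matrix (Fin 2) (Fin 2) ℤ)) 0 0 : ℤ) : ZMod n) = 1 :=
    congrFun (congrFun hf 0) 0
  rw [e01] at h01
  rw [e00] at h00
  refine ⟨(ZMod.intCast_zmod_eq_zero_iff_dvd _ _).1 h01, ?_⟩
  rw [← ZMod.intCast_zmod_eq_zero_iff_dvd]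
  push_cast
  rw [h00, sub_self]

/-- Binomial expansion of `(u M + α)^n` to first order in `u`; Cayley-Hamilton folds the higher
terms into `y` and `z`. -/
theorem pow_eq_smul_add_smul_pow {M : Matrix (Fin 2) (Fin 2) ℤ} {m : ℕ} {u α : ℤ}
    (h : M ^ m = u • M + α • (1 : Matrix (Fin 2) (Fin 2) ℤ)) (n : ℕ) :
    ∃ y z : ℤ, M ^ (m * n) = (n * u * α ^ (n - 1) + u ^ 2 * y) • M +
      (α ^ n + u ^ 2 * z) • (1 : Matrix (Fin 2) (Fin 2) ℤ) := by
  induction n with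
  | zero => exact ⟨0, 0, by simp⟩
  | succ n ih =>
    obtain ⟨y, z, hyz⟩ := ih
    have hM := sq_eq_trace_smul_sub_det_smul M
    have key : ∀ a b : ℤ, (a • M + b • (1 : Matrix (Fin 2) (Fin 2) ℤ)) * (u • M + α • 1) =
        (a * u * M.trace + a * α + b * u) • M + (b * α - a * u * M.det) • 1 := by
      intro a b
      rw [add_mul, mul_add, mul_add, smul_mul_smul_comm, hM]
      simp only [smul_mul_smul_comm, mul_one, one_mul]
      module
    refine ⟨(n * α ^ (n - 1) + u * y) * M.trace + y * α + z * u,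
      z * α - (n * α ^ (n - 1) + u * y) * M.det, ?_⟩
    rw [Nat.mul_succ, pow_add, hyz, h, key]
    rcases n with _ | n
    · congr 2 <;> push_cast <;> ring
    · congr 2 <;> push_cast [Nat.add_sub_cancel] <;> ring

/-- Each `p`-th power multiplies the coefficient of `M` by `p` times a number that is 1 modulo `p`.
The square in `p ^ 2 ∣ u₀` makes the quadratic remainder negligible already at `j = 0`. -/
theorem exists_pow_level {p : ℕ} {M : Matrix (Fin 2) (Fin 2) ℤ}
    {m₀ : ℕ} {u₀ α₀ : ℤ} (h₀ : M ^ m₀ = u₀ • M + α₀ • (1 : Matrix (Fin 2) (Fin 2) ℤ))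
    (hu : (p : ℤ) ^ 2 ∣ u₀) (hα : (p : ℤ) ∣ α₀ - 1) (j : ℕ) :
    ∃ (m : ℕ) (s α : ℤ), M ^ m = ((p : ℤ) ^ j * u₀ * s) • M + α • 1 ∧
      (p : ℤ) ∣ s - 1 ∧ (p : ℤ) ∣ α - 1 := by
  induction j with
  | zero => exact ⟨m₀, 1, α₀, by simpa using h₀, by simp, hα⟩
  | succ j ih =>
    obtain ⟨m, s, α, h, hs, ha⟩ := ih
    obtain ⟨y, z, hyz⟩ := pow_eq_smul_add_smul_pow h p
    obtain ⟨c, rfl⟩ := hu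
    have hp1 : ∀ k : ℕ, (p : ℤ) ∣ α ^ k - 1 := fun k =>
      ha.trans (by simpa using sub_dvd_pow_sub_pow α 1 k)
    refine ⟨m * p, s * (α ^ (p - 1) + p * (p ^ j * c * s * y)),
      α ^ p + (p ^ j * (p ^ 2 * c) * s) ^ 2 * z, ?_, ?_, ?_⟩
    · rw [hyz]
      congr 2
      ring
    · obtain ⟨a, ha'⟩ := hp1 (p - 1)
      obtain ⟨b, hb⟩ := hs
      rw [sub_eq_iff_eq_add] at ha' hb
      rw [ha', hb]
      exact ⟨b * (p * a + 1 + p * (p ^ j * c * (p * b + 1) * y)) + a +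
        (p ^ j * c * (p * b + 1) * y), by ring⟩
    · rw [add_sub_right_comm]
      exact (hp1 p).add ⟨(p : ℤ) * ((p : ℤ) ^ j * c * s) ^ 2 * p ^ 2 * z, by ring⟩

/-- The leading digit `n` at level `j` can be prescribed, which allows cancelling one `p`-adic digit
at a time. -/
theorem exists_pow_level_coeff {p : ℕ} {M : Matrix (Fin 2) (Fin 2) ℤ}
    {m₀ : ℕ} {u₀ α₀ : ℤ} (h₀ : M ^ m₀ = u₀ • M + α₀ • (1 : Matrix (Fin 2) (Fin 2) ℤ))
    (hu : (p : ℤ) ^ 2 ∣ u₀) (hα : (p : ℤ) ∣ α₀ - 1) (j n : ℕ) :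
    ∃ (m : ℕ) (e f : ℤ), M ^ m = ((p : ℤ) ^ j * u₀ * (n + p * e)) • M + (1 + p * f) • 1 := by
  obtain ⟨m, s, α, h, ⟨b, hb⟩, ha⟩ := exists_pow_level h₀ hu hα j
  obtain ⟨y, z, hyz⟩ := pow_eq_smul_add_smul_pow h n
  obtain ⟨c, rfl⟩ := hu
  have hp1 : ∀ k : ℕ, (p : ℤ) ∣ α ^ k - 1 := fun k =>
    ha.trans (by simpa using sub_dvd_pow_sub_pow α 1 k)
  obtain ⟨a₁, h₁⟩ := hp1 (n - 1)
  obtain ⟨a₂, h₂⟩ := hp1 n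
  rw [sub_eq_iff_eq_add] at hb h₁ h₂
  refine ⟨m * n, n * (b * (p * a₁ + 1) + a₁) + p ^ j * c * s ^ 2 * p * y,
    a₂ + p ^ 3 * (p ^ j * c * s) ^ 2 * z, ?_⟩
  rw [hyz, h₁, h₂, hb]
  congr 2 <;> ring

/-! ### The action on the `p`-adic plane and ultrametric estimates -/

theorem padicLin_apply (p : ℕ) [Fact p.Prime] (M : Matrix (Fin 2) (Fin 2) ℤ)
    (x : Fin 2 → ℚ_[p]) (i : Fin 2) :
    padicLin p M x i = (M i 0 : ℚ_[p]) * x 0 + (M i 1 : ℚ_[p]) * x 1 := by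
  simp [padicLin, Matrix.mulVec, dotProduct, Fin.sum_univ_two]

theorem padicLin_one (p : ℕ) [Fact p.Prime] (x : Fin 2 → ℚ_[p]) : padicLin p 1 x = x := by
  ext i
  fin_cases i <;> simp [padicLin_apply]

theorem padicLin_mul (p : ℕ) [Fact p.Prime] (M M' : Matrix (Fin 2) (Fin 2) ℤ)
    (x : Fin 2 → ℚ_[p]) : padicLin p (M * M') x = padicLin p M (padicLin p M' x) := by
  ext i
  simp only [padicLin_apply, Matrix.mul_apply, Fin.sum_univ_two]
  push_cast
  ring

theorem padicLin_smul_add_smul (p : ℕ) [Fact p.Prime] (M : Matrix (Fin 2) (Fin 2) ℤ) (u α : ℤ)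
    (x : Fin 2 → ℚ_[p]) :
    padicLin p (u • M + α • (1 : Matrix (Fin 2) (Fin 2) ℤ)) x =
      (u : ℚ_[p]) • padicLin p M x + (α : ℚ_[p]) • x := by
  ext i
  rw [padicLin_apply, Matrix.add_apply, Matrix.add_apply, Matrix.smul_apply, Matrix.smul_apply,
    Matrix.smul_apply, Matrix.smul_apply]
  revert i
  rw [Fin.forall_fin_two]
  constructor <;> simp [padicLin_apply] <;> ring

theorem padicLin_padicLin (p : ℕ) [Fact p.Prime] (M : Matrix (Fin 2) (Fin 2) ℤ)
    (x : Fin 2 → ℚ_[p]) : padicLin p M (padicLin p M x) =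
      (M.trace : ℚ_[p]) • padicLin p M x - (M.det : ℚ_[p]) • x := by
  ext i
  fin_cases i <;> simp [padicLin_apply, Matrix.trace_fin_two, Matrix.det_fin_two] <;> ring

theorem norm_add_le_of_le {p : ℕ} [Fact p.Prime] {x y : ℚ_[p]} {c : ℝ} (hx : ‖x‖ ≤ c)
    (hy : ‖y‖ ≤ c) : ‖x + y‖ ≤ c :=
  (Padic.nonarchimedean x y).trans (max_le hx hy)

theorem norm_intCast_mul_le {p : ℕ} [Fact p.Prime] (n : ℤ) {x : ℚ_[p]} {c : ℝ} (hx : ‖x‖ ≤ c) :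
    ‖(n : ℚ_[p]) * x‖ ≤ c := by
  rw [norm_mul]
  exact (mul_le_of_le_one_left (norm_nonneg _) (Padic.norm_int_le_one n)).trans hx

theorem norm_p_mul_le {p : ℕ} [Fact p.Prime] {x : ℚ_[p]} {c : ℝ} (hx : ‖x‖ ≤ c) :
    ‖(p : ℚ_[p]) * x‖ ≤ (p : ℝ)⁻¹ * c := by
  rw [norm_mul, Padic.norm_p]
  gcongr

theorem exists_natCast_norm_add_le {p : ℕ} [hp : Fact p.Prime] {z : ℚ_[p]} (hz : ‖z‖ ≤ 1) :
    ∃ n : ℕ, ‖(n : ℚ_[p]) + z‖ ≤ (p : ℝ)⁻¹ := by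
  obtain ⟨y, rfl⟩ : ∃ y : ℤ_[p], (y : ℚ_[p]) = z := ⟨⟨z, hz⟩, rfl⟩
  obtain ⟨n, -, hn⟩ := PadicInt.exists_mem_range (p := p) (-y)
  refine ⟨n, ?_⟩
  rw [PadicInt.maximalIdeal_eq_span_p, Ideal.mem_span_singleton] at hn
  obtain ⟨c, hc⟩ := hn
  have : (n : ℚ_[p]) + y = -((p : ℚ_[p]) * c) := by
    have h := congrArg (fun x : ℤ_[p] => (x : ℚ_[p])) hc
    push_cast at h
    rw [← h]
    ring
  rw [this, norm_neg]
  simpa using norm_p_mul_le c.norm_le_one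

/-- Hensel-type approximation: a linear form with integer coefficients, small enough at `q`,
takes arbitrarily small values on the orbit of `q`, while remaining constant in absolute value
at the successors. -/
theorem exists_pow_norm_le {p : ℕ} [hp : Fact p.Prime] {M : Matrix (Fin 2) (Fin 2) ℤ}
    {m₀ : ℕ} {u₀ α₀ : ℤ} (h₀ : M ^ m₀ = u₀ • M + α₀ • (1 : Matrix (Fin 2) (Fin 2) ℤ))
    (hu : (p : ℤ) ^ 2 ∣ u₀) (hu₀ : u₀ ≠ 0) (hα : (p : ℤ) ∣ α₀ - 1)
    (φ : (Fin 2 → ℚ_[p]) →ₗ[ℚ_[p]] ℚ_[p]) {q : Fin 2 → ℚ_[p]} (hq : φ (padicLin p M q) ≠ 0)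
    (h : ‖φ q‖ ≤ ‖(u₀ : ℚ_[p])‖ * ‖φ (padicLin p M q)‖) (j : ℕ) :
    ∃ k : ℕ, ‖φ (padicLin p (M ^ k) q)‖ ≤
        (p : ℝ)⁻¹ ^ j * ‖(u₀ : ℚ_[p])‖ * ‖φ (padicLin p M q)‖ ∧
      ‖φ (padicLin p M (padicLin p (M ^ k) q))‖ = ‖φ (padicLin p M q)‖ := by
  induction j with
  | zero => exact ⟨0, by simpa [padicLin_one] using h, by simp [padicLin_one]⟩
  | succ j ih =>
    obtain ⟨k, hk, hb⟩ := ih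
    set x := padicLin p (M ^ k) q with hx
    set a := φ x with ha
    set b := φ (padicLin p M x) with hbdef
    set β := ‖φ (padicLin p M q)‖ with hβ
    have hβ0 : 0 < β := norm_pos_iff.2 hq
    have hp0 : (p : ℚ_[p]) ≠ 0 := by exact_mod_cast hp.out.ne_zero
    have hu0' : (u₀ : ℚ_[p]) ≠ 0 := by exact_mod_cast hu₀
    have hb0 : b ≠ 0 := norm_pos_iff.1 (hb ▸ hβ0)
    set c : ℚ_[p] := (p : ℚ_[p]) ^ j * u₀ * b with hc
    have hc0 : c ≠ 0 := mul_ne_zero (mul_ne_zero (pow_ne_zero _ hp0) hu0') hb0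
    have hcn : ‖c‖ = (p : ℝ)⁻¹ ^ j * ‖(u₀ : ℚ_[p])‖ * β := by
      rw [hc, norm_mul, norm_mul, norm_pow, Padic.norm_p, hb]
    rw [← hcn] at hk
    have hcβ : ‖c‖ ≤ β := by
      have : c = ((p ^ j * u₀ : ℤ) : ℚ_[p]) * b := by rw [hc]; push_cast; ring
      rw [this]
      exact norm_intCast_mul_le _ hb.le
    -- To leading order, a level `j` power with digit `n` changes `a` into `a + n c`; the digit is
    -- chosen as `-a / c` modulo `p`.
    obtain ⟨n, hn⟩ := exists_natCast_norm_add_le (p := p) (z := a / c) (by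
      rw [norm_div]
      exact div_le_one_of_le₀ hk (norm_nonneg _))
    obtain ⟨m, e, f, hm⟩ := exists_pow_level_coeff h₀ hu hα j n
    obtain ⟨u₁, hu₁⟩ := hu
    have hx' : padicLin p (M ^ (m + k)) q =
        ((p : ℚ_[p]) ^ j * u₀ * (n + p * e)) • padicLin p M x + (1 + p * f : ℚ_[p]) • x := by
      rw [pow_add, padicLin_mul, ← hx, hm, padicLin_smul_add_smul]
      push_cast
      rfl
    refine ⟨m + k, ?_, ?_⟩
    · have : φ (padicLin p (M ^ (m + k)) q) =
          c * (n + a / c) + p * (e * c + f * a) := by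
        rw [hx', map_add, map_smul, map_smul, ← ha, ← hbdef, smul_eq_mul, smul_eq_mul]
        field_simp
        rw [hc]
        ring
      have hr : (p : ℝ)⁻¹ ^ (j + 1) * ‖(u₀ : ℚ_[p])‖ * β = (p : ℝ)⁻¹ * ‖c‖ := by
        rw [hcn]
        ring
      rw [this, hr]
      refine norm_add_le_of_le ?_ (norm_p_mul_le (norm_add_le_of_le
        (norm_intCast_mul_le _ le_rfl) (norm_intCast_mul_le _ hk)))
      rw [norm_mul, mul_comm]
      gcongr
    -- The value at the successor changes only by `p` times something of norm at most `β`, so the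
    -- ultrametric inequality preserves its norm.
    · have : φ (padicLin p M (padicLin p (M ^ (m + k)) q)) =
          p * (((p ^ j * p * u₁ * (n + p * e) : ℤ) : ℚ_[p]) *
            ((M.trace : ℚ_[p]) * b + ((-M.det : ℤ) : ℚ_[p]) * a) + f * b) + b := by
        rw [hx', map_add, map_smul, map_smul, padicLin_padicLin, map_add, map_smul, map_smul,
          map_sub, map_smul, map_smul, ← ha, ← hbdef, hu₁]
        push_cast
        simp only [smul_eq_mul]
        ring
      have hlt : ‖p * (((p ^ j * p * u₁ * (n + p * e) : ℤ) : ℚ_[p]) *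
            ((M.trace : ℚ_[p]) * b + ((-M.det : ℤ) : ℚ_[p]) * a) + f * b)‖ < ‖b‖ := by
        refine (norm_p_mul_le (c := β) (norm_add_le_of_le (norm_intCast_mul_le _
          (norm_add_le_of_le (norm_intCast_mul_le _ hb.le)
          (norm_intCast_mul_le _ (hk.trans hcβ)))) (norm_intCast_mul_le _ hb.le))).trans_lt ?_
        rw [hb]
        exact mul_lt_of_lt_one_left hβ0 (inv_lt_one_of_one_lt₀ (by exact_mod_cast hp.out.one_lt))
      rw [this, Padic.add_eq_max_of_ne hlt.ne, max_eq_right hlt.le, hb]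

/-! ### Iterates of `T` and periodic points -/

variable {p : ℕ} [hp : Fact p.Prime]

theorem PBadEps_anti {ε δ : ℝ} (h : δ ≤ ε) : PBadEps p ε ⊆ PBadEps p δ := by
  intro x hx q hq hqx a b hab
  exact (by gcongr : δ / (max |(a : ℝ)| |(b : ℝ)|) ^ 2 ≤ ε / (max |(a : ℝ)| |(b : ℝ)|) ^ 2).trans
    (hx q hq hqx a b hab)

/-- The letters act in the order `A_{a_n} ⋯ A_{a_1}`, which is the transpose of the word matrix
since each letter matrix is symmetric. -/
theorem iterate_T (w : ℕ → ℕ) (q : Fin 2 → ℚ_[p]) (hq : q ≠ 0) (n : ℕ) :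
    ∃ h : padicLin p (wordMatrix (wordPrefix w n))ᵀ q ≠ 0,
      (T p)^[n] (w, Projectivization.mk ℚ_[p] q hq) =
        (fun i => w (i + n), Projectivization.mk ℚ_[p] _ h) := by
  induction n with
  | zero =>
    have : padicLin p (wordMatrix (wordPrefix w 0))ᵀ q = q := by
      simp [wordPrefix, wordMatrix, padicLin_one]
    simp only [this]
    exact ⟨hq, rfl⟩
  | succ n ih =>
    obtain ⟨h, ih⟩ := ih
    have : padicLin p (wordMatrix (wordPrefix w (n + 1)))ᵀ q =
        padicLin p (letterMatrix (w n)) (padicLin p (wordMatrix (wordPrefix w n))ᵀ q) := by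
      rw [← padicLin_mul]
      congr 2
      have hs : (letterMatrix (w n))ᵀ = letterMatrix (w n) := by
        ext i j
        fin_cases i <;> fin_cases j <;> rfl
      simp [wordPrefix, wordMatrix, List.range_succ, Matrix.transpose_mul, hs]
    simp only [this]
    refine ⟨(map_ne_zero_iff _ (padicLin_letterMatrix_injective p (w n))).2 h, ?_⟩
    rw [Function.iterate_succ_apply', ih, T]
    simp only [Projectivization.map_mk, zero_add]
    congr 1
    ext i
    congr 1
    ring

theorem iterate_T_mul {w : ℕ → ℕ} {l : ℕ} (hw : Function.Periodic w l) (q : Fin 2 → ℚ_[p])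
    (hq : q ≠ 0) (k : ℕ) :
    ∃ h : padicLin p ((wordMatrix (wordPrefix w l))ᵀ ^ k) q ≠ 0,
      (T p)^[l * k] (w, Projectivization.mk ℚ_[p] q hq) =
        (w, Projectivization.mk ℚ_[p] _ h) := by
  induction k with
  | zero => simpa [padicLin_one] using hq
  | succ k ih =>
    obtain ⟨h, ih⟩ := ih
    obtain ⟨h', e⟩ := iterate_T w _ h l
    simp only [pow_succ', padicLin_mul]
    refine ⟨h', ?_⟩
    rw [Nat.mul_succ, Nat.add_comm, Function.iterate_add_apply, ih, e]
    congr 1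
    exact funext hw

theorem isEigenpoint_mk_iff {M : Matrix (Fin 2) (Fin 2) ℤ} {q : Fin 2 → ℚ_[p]} (hq : q ≠ 0) :
    IsEigenpoint p M (Projectivization.mk ℚ_[p] q hq) ↔ ∃ μ : ℚ_[p], padicLin p M q = μ • q := by
  constructor
  · rintro ⟨μ, v, hv, h⟩
    obtain ⟨a, rfl⟩ := (Projectivization.mk_eq_mk_iff' _ _ _ _ _).1 h
    exact ⟨μ, by rw [map_smul, hv.apply_eq_smul, smul_comm]⟩
  · rintro ⟨μ, h⟩
    exact ⟨μ, q, ⟨Module.End.mem_eigenspace_iff.2 h, hq⟩, rfl⟩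

/-- Periodicity passes along an orbit, so this carries the eigenvector property to the shifted words
and their matrices. -/
theorem isPeriodicPt_T_iff {w : ℕ → ℕ} {l : ℕ} (hw : Function.Periodic w l) (x : P1 p) :
    Function.IsPeriodicPt (T p) l (w, x) ↔
      IsEigenpoint p (wordMatrix (wordPrefix w l))ᵀ x := by
  induction x using Projectivization.ind with | h q hq
  rw [isEigenpoint_mk_iff]
  obtain ⟨h, e⟩ := iterate_T w q hq l
  rw [Function.IsPeriodicPt, Function.IsFixedPt, e, show (fun i => w (i + l)) = w from funext hw,
    Prod.mk.injEq, Projectivization.mk_eq_mk_iff']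
  simp [eq_comm]

/-! ### Eigenpoints are badly approximable -/

theorem one_le_norm_mul_abs {n : ℤ} (hn : n ≠ 0) : 1 ≤ ‖(n : ℚ_[p])‖ * (|n| : ℤ) := by
  have hp0 : (0 : ℝ) < p := by exact_mod_cast hp.out.pos
  have h1 : ‖(n : ℚ_[p])‖ = ((p : ℝ) ^ padicValInt p n)⁻¹ := by
    have h := Padic.eq_padicNorm (p := p) (n : ℚ)
    rw [padicNorm.eq_zpow_of_nonzero (by exact_mod_cast hn), padicValRat.of_int] at h
    simpa using h
  have h2 : (p : ℤ) ^ padicValInt p n ≤ |n| :=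
    Int.le_of_dvd (abs_pos.2 hn) ((dvd_abs _ _).2 (padicValInt_dvd n))
  rw [h1, inv_mul_eq_div, one_le_div (by positivity)]
  exact_mod_cast h2

/-- For a matrix without nonzero rational isotropic vectors of `det [v; v M]`, the eigenvectors
are `p`-adically badly approximable. -/
theorem exists_mem_PBadEps_of_isEigenpoint {M : Matrix (Fin 2) (Fin 2) ℤ}
    (hM : ∀ a b : ℤ, M 0 1 * a ^ 2 + (M 1 1 - M 0 0) * a * b - M 1 0 * b ^ 2 = 0 → a = 0 ∧ b = 0)
    {x : P1 p} (hx : IsEigenpoint p M x) : ∃ ε : ℝ, 0 < ε ∧ x ∈ PBadEps p ε := by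
  induction x using Projectivization.ind with | h q hq
  obtain ⟨μ, hμ⟩ := (isEigenpoint_mk_iff hq).1 hx
  set C : ℝ := max 1 ‖μ‖ with hC
  set S : ℤ := |M 0 1| + |M 1 1 - M 0 0| + |M 1 0| + 1 with hS
  have hC0 : 0 < C := lt_max_of_lt_left one_pos
  have hS0 : (0 : ℝ) < S := by exact_mod_cast (by positivity : 0 < S)
  -- `C` bounds the `p`-adic cofactors below, and `S` bounds `|Q|` relative to `max(|a|, |b|)²`.
  refine ⟨(C * S)⁻¹, by positivity, fun r hr hrq a b hab => ?_⟩
  obtain ⟨c, rfl⟩ := (Projectivization.mk_eq_mk_iff' _ _ _ _ _).1 hrq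
  replace hμ : padicLin p M (c • q) = μ • c • q := by rw [map_smul, hμ, smul_comm]
  generalize c • q = r at *
  have h0 := congrFun hμ 0
  have h1 := congrFun hμ 1
  rw [padicLin_apply, Pi.smul_apply, smul_eq_mul] at h0 h1
  set Q : ℤ := M 0 1 * a ^ 2 + (M 1 1 - M 0 0) * a * b - M 1 0 * b ^ 2 with hQ
  set L : ℚ_[p] := (a : ℚ_[p]) * r 0 + (b : ℚ_[p]) * r 1 with hL
  set m : ℝ := max |(a : ℝ)| |(b : ℝ)| with hm
  have hQ0 : Q ≠ 0 := fun h => hab (by simpa using hM a b h)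
  have ham : |(a : ℝ)| ≤ m := le_max_left _ _
  have hbm : |(b : ℝ)| ≤ m := le_max_right _ _
  have hm0 : 0 < m := by
    by_contra! h
    have ha := abs_nonpos_iff.1 (ham.trans h)
    have hb := abs_nonpos_iff.1 (hbm.trans h)
    exact hab (by simpa using And.intro ha hb)
  have hQle : (|Q| : ℤ) ≤ (S : ℝ) * m ^ 2 := by
    have e1 : |(M 0 1 : ℝ) * a ^ 2| ≤ |(M 0 1 : ℝ)| * m ^ 2 := by
      rw [abs_mul, abs_pow]
      gcongr
    have e2 : |((M 1 1 : ℝ) - M 0 0) * a * b| ≤ |(M 1 1 : ℝ) - M 0 0| * m ^ 2 := by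
      rw [abs_mul, abs_mul, mul_assoc, sq]
      gcongr
    have e3 : |(M 1 0 : ℝ) * b ^ 2| ≤ |(M 1 0 : ℝ)| * m ^ 2 := by
      rw [abs_mul, abs_pow]
      gcongr
    rw [hQ, hS]
    push_cast
    refine (abs_sub _ _).trans ?_
    linarith [abs_add_le ((M 0 1 : ℝ) * a ^ 2) (((M 1 1 : ℝ) - M 0 0) * a * b), sq_nonneg m]
  have hQp : 1 ≤ ‖(Q : ℚ_[p])‖ * (|Q| : ℤ) := one_le_norm_mul_abs hQ0
  have hint : ∀ s t : ℤ, ‖(s : ℚ_[p]) - t * μ‖ ≤ C := fun s t => by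
    rw [sub_eq_add_neg]
    refine norm_add_le_of_le ((Padic.norm_int_le_one s).trans (le_max_left _ _)) ?_
    rw [norm_neg]
    exact norm_intCast_mul_le t (le_max_right _ _)
  have hQr : ∀ i, ‖(Q : ℚ_[p])‖ * ‖r i‖ ≤ ‖L‖ * C := by
    rw [Fin.forall_fin_two]
    -- Cramer's rule for the system `v · r = L`, `v M · r = μ L` with `v = (a, b)`, whose
    -- determinant is `Q`.
    have e0 : (Q : ℚ_[p]) * r 0 = L * (((a * M 0 1 + b * M 1 1 : ℤ) : ℚ_[p]) - b * μ) := by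
      rw [hQ, hL]
      push_cast
      linear_combination (-a * b) * h0 - b ^ 2 * h1
    have e1 : (Q : ℚ_[p]) * r 1 = -(L * (((a * M 0 0 + b * M 1 0 : ℤ) : ℚ_[p]) - a * μ)) := by
      rw [hQ, hL]
      push_cast
      linear_combination a ^ 2 * h0 + a * b * h1
    constructor
    · rw [← norm_mul, e0, norm_mul]
      gcongr
      exact hint _ _
    · rw [← norm_mul, e1, norm_neg, norm_mul]
      gcongr
      exact hint _ _
  have hr0 : 0 < max ‖r 0‖ ‖r 1‖ := by
    by_contra! h
    apply hr
    ext i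
    have h2 : ∀ i, r i = 0 := Fin.forall_fin_two.2
      ⟨norm_le_zero_iff.1 ((le_max_left _ _).trans h), norm_le_zero_iff.1 ((le_max_right _ _).trans h)⟩
    exact h2 i
  have hQr' : ‖(Q : ℚ_[p])‖ * max ‖r 0‖ ‖r 1‖ ≤ ‖L‖ * C := by
    rcases max_choice ‖r 0‖ ‖r 1‖ with h | h <;> rw [h]
    exacts [hQr 0, hQr 1]
  rw [div_le_div_iff₀ (by positivity) hr0, inv_mul_le_iff₀ (by positivity)]
  calc max ‖r 0‖ ‖r 1‖ ≤ (‖(Q : ℚ_[p])‖ * (|Q| : ℤ)) * max ‖r 0‖ ‖r 1‖ :=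
        le_mul_of_one_le_left hr0.le hQp
    _ = (‖(Q : ℚ_[p])‖ * max ‖r 0‖ ‖r 1‖) * (|Q| : ℤ) := by ring
    _ ≤ (‖L‖ * C) * (S * m ^ 2) := by
      gcongr
    _ = _ := by ring

/-! ### Nonsquare discriminants and positive word matrices -/

/-- A binary quadratic form whose discriminant is not a square is anisotropic. -/
theorem eq_zero_of_quadratic_eq_zero {α β γ a b : ℤ} (hα : α ≠ 0)
    (hD : ∀ k : ℤ, k ^ 2 ≠ β ^ 2 - 4 * α * γ) (h : α * a ^ 2 + β * a * b + γ * b ^ 2 = 0) :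
    a = 0 ∧ b = 0 := by
  have hX : (2 * α * a + β * b) ^ 2 = (β ^ 2 - 4 * α * γ) * b ^ 2 := by
    linear_combination 4 * α * h
  have hb : b = 0 := by
    by_contra hb
    obtain ⟨k, hk⟩ := (Int.pow_dvd_pow_iff two_ne_zero).1 (Dvd.intro_left _ hX.symm)
    apply hD k
    rw [hk] at hX
    exact mul_right_cancel₀ (pow_ne_zero 2 hb) (by linear_combination hX)
  subst hb
  simpa [hα] using h

theorem sq_ne_sq_add_four {t : ℤ} (ht : 1 ≤ t) (k : ℤ) : k ^ 2 ≠ t ^ 2 + 4 := by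
  intro h
  wlog hk : 0 ≤ k generalizing k
  · exact this (-k) (by rw [neg_sq, h]) (by lia)
  obtain ⟨s, rfl⟩ : ∃ s, k = t + s := ⟨k - t, by ring⟩
  have h1 : 0 < s := by nlinarith
  have h2 : s < 2 := by nlinarith
  obtain rfl : s = 1 := by lia
  have : 2 * t = 3 := by linear_combination h
  lia

theorem sq_ne_sq_sub_four {t : ℤ} (ht : 3 ≤ t) (k : ℤ) : k ^ 2 ≠ t ^ 2 - 4 := by
  intro h
  wlog hk : 0 ≤ k generalizing k
  · exact this (-k) (by rw [neg_sq, h]) (by lia)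
  obtain ⟨s, rfl⟩ : ∃ s, k = t - s := ⟨t - k, by ring⟩
  have h1 : 0 < s := by nlinarith
  have h2 : s < 2 := by nlinarith
  obtain rfl : s = 1 := by lia
  have : 2 * t = 5 := by linear_combination -h
  lia

/-- Integer matrices with the sign pattern of the products of the letter matrices. -/
structure IsPositiveWordMatrix (M : Matrix (Fin 2) (Fin 2) ℤ) : Prop where
  zero_zero : 0 ≤ M 0 0
  zero_one : 1 ≤ M 0 1
  one_zero : 1 ≤ M 1 0
  one_one : 1 ≤ M 1 1
  det : M.det = 1 ∨ M.det = -1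

theorem isPositiveWordMatrix_letterMatrix {a : ℕ} (ha : 1 ≤ a) :
    IsPositiveWordMatrix (letterMatrix a) := by
  refine ⟨?_, ?_, ?_, ?_, .inr (det_letterMatrix a)⟩ <;> simp [letterMatrix]
  exact_mod_cast ha

namespace IsPositiveWordMatrix

variable {M M' : Matrix (Fin 2) (Fin 2) ℤ}

theorem mul (h : IsPositiveWordMatrix M) (h' : IsPositiveWordMatrix M') :
    IsPositiveWordMatrix (M * M') := by
  obtain ⟨h1, h2, h3, h4, h5⟩ := h
  obtain ⟨k1, k2, k3, k4, k5⟩ := h'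
  constructor
  · simp only [Matrix.mul_apply, Fin.sum_univ_two]; nlinarith
  · simp only [Matrix.mul_apply, Fin.sum_univ_two]; nlinarith
  · simp only [Matrix.mul_apply, Fin.sum_univ_two]; nlinarith
  · simp only [Matrix.mul_apply, Fin.sum_univ_two]; nlinarith
  · rw [Matrix.det_mul]
    rcases h5 with h | h <;> rcases k5 with k | k <;> simp [h, k]

theorem transpose (h : IsPositiveWordMatrix M) : IsPositiveWordMatrix Mᵀ :=
  ⟨h.zero_zero, h.one_zero, h.zero_one, h.one_one, by rw [Matrix.det_transpose]; exact h.det⟩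

theorem pow (h : IsPositiveWordMatrix M) {n : ℕ} (hn : 0 < n) : IsPositiveWordMatrix (M ^ n) := by
  induction n, hn using Nat.le_induction with
  | base => simpa using h
  | succ n _ ih => rw [pow_succ]; exact ih.mul h

theorem isUnit_det (h : IsPositiveWordMatrix M) : IsUnit M.det := Int.isUnit_iff.2 h.det

/-- The discriminant is `tr² - 4 det`. If `det = 1`, then `M 0 0 * M 1 1 ≥ 2`, which forces trace at
least 3. -/
theorem anisotropic (h : IsPositiveWordMatrix M) (a b : ℤ)
    (hab : M 0 1 * a ^ 2 + (M 1 1 - M 0 0) * a * b - M 1 0 * b ^ 2 = 0) : a = 0 ∧ b = 0 := by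
  obtain ⟨h1, h2, h3, h4, h5⟩ := h
  rw [Matrix.det_fin_two] at h5
  refine eq_zero_of_quadratic_eq_zero (α := M 0 1) (β := M 1 1 - M 0 0) (γ := -M 1 0) (by lia) (fun k hk => ?_)
    (by linear_combination hab)
  rcases h5 with h5 | h5
  · refine sq_ne_sq_sub_four (t := M 0 0 + M 1 1) ?_ k (by linear_combination hk - 4 * h5)
    have : 0 < M 0 0 := by
      rcases h1.eq_or_lt with h0 | h0
      · rw [← h0] at h5
        nlinarith
      · exact h0
    nlinarith
  · exact sq_ne_sq_add_four (t := M 0 0 + M 1 1) (by lia) k (by linear_combination hk - 4 * h5)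

end IsPositiveWordMatrix

theorem isPositiveWordMatrix_wordPrefix {N : ℕ} {w : ℕ → ℕ} (hw : w ∈ words N) {l : ℕ}
    (hl : 0 < l) : IsPositiveWordMatrix (wordMatrix (wordPrefix w l)) := by
  induction l, hl using Nat.le_induction with
  | base => simpa [wordMatrix, wordPrefix] using isPositiveWordMatrix_letterMatrix (hw 0).1
  | succ n _ ih =>
    have : wordMatrix (wordPrefix w (n + 1)) =
        wordMatrix (wordPrefix w n) * letterMatrix (w n) := by
      simp [wordPrefix, wordMatrix, List.range_succ]
    rw [this]
    exact ih.mul (isPositiveWordMatrix_letterMatrix (hw n).1)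

/-! ### Points that are not eigenpoints -/

/-- Over a point which is not an eigenvector, some integral linear form is small compared with its
value at the image of the point. -/
theorem exists_int_norm_le {M : Matrix (Fin 2) (Fin 2) ℤ} {q : Fin 2 → ℚ_[p]} (hq : q ≠ 0)
    (hM : ¬ ∃ μ : ℚ_[p], padicLin p M q = μ • q) {δ : ℝ} (hδ : 0 < δ) :
    ∃ a b : ℤ, ‖(a : ℚ_[p]) * q 0 + b * q 1‖ <
      δ * ‖(a : ℚ_[p]) * padicLin p M q 0 + b * padicLin p M q 1‖ := by
  -- The form `(-q 1, q 0)` kills `q` but not its image. Scaled by `p ^ k` it has coefficients in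
  -- `ℤ_[p]`; the desired inequality is open and the integers are dense there.
  obtain ⟨k, hk⟩ : ∃ k : ℕ, ∀ i, ‖(p : ℚ_[p]) ^ k * q i‖ ≤ 1 := by
    have hlim : ∀ i, ∀ᶠ k : ℕ in Filter.atTop, ‖(p : ℚ_[p]) ^ k * q i‖ ≤ 1 := fun i => by
      have h : Filter.Tendsto (fun k : ℕ => ‖(p : ℚ_[p]) ^ k * q i‖) Filter.atTop (nhds 0) := by
        have h0 : Filter.Tendsto (fun k : ℕ => (p : ℚ_[p]) ^ k * q i) Filter.atTop
            (nhds (0 * q i)) := by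
          refine (tendsto_pow_atTop_nhds_zero_of_norm_lt_one ?_).mul_const _
          exact Padic.norm_p_lt_one
        simpa using h0.norm
      exact h.eventually_le_const one_pos
    exact (Filter.eventually_all.2 hlim).exists
  have hp0 : (p : ℚ_[p]) ^ k ≠ 0 := pow_ne_zero _ (by exact_mod_cast hp.out.ne_zero)
  set y := padicLin p M q with hy
  have hdet : q 0 * y 1 - q 1 * y 0 ≠ 0 := by
    intro h
    apply hM
    by_cases h0 : q 0 = 0
    · have h1 : q 1 ≠ 0 := fun h1 => hq (by ext i; fin_cases i <;> simp [h0, h1])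
      refine ⟨y 1 / q 1, funext (Fin.forall_fin_two.2 ⟨?_, ?_⟩)⟩
      · simpa [h0, h1] using h
      · simp [h1]
    · refine ⟨y 0 / q 0, funext (Fin.forall_fin_two.2 ⟨?_, ?_⟩)⟩
      · simp [h0]
      · simp only [Pi.smul_apply, smul_eq_mul]
        field_simp
        linear_combination h
  let f : ℤ_[p] × ℤ_[p] → ℝ := fun v =>
    δ * ‖(v.1 : ℚ_[p]) * y 0 + v.2 * y 1‖ - ‖(v.1 : ℚ_[p]) * q 0 + v.2 * q 1‖
  have hf : Continuous f := by
    have h1 : Continuous fun v : ℤ_[p] × ℤ_[p] => (v.1 : ℚ_[p]) :=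
      continuous_subtype_val.comp continuous_fst
    have h2 : Continuous fun v : ℤ_[p] × ℤ_[p] => (v.2 : ℚ_[p]) :=
      continuous_subtype_val.comp continuous_snd
    fun_prop
  obtain ⟨⟨a, b⟩, hab⟩ := ((PadicInt.denseRange_intCast (p := p)).prodMap
    (PadicInt.denseRange_intCast (p := p))).exists_mem_open (isOpen_lt continuous_const hf :
      IsOpen {v | 0 < f v}) ⟨(-⟨_, hk 1⟩, ⟨_, hk 0⟩), by
      have e1 : -((p : ℚ_[p]) ^ k * q 1) * y 0 + (p : ℚ_[p]) ^ k * q 0 * y 1 =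
        (p : ℚ_[p]) ^ k * (q 0 * y 1 - q 1 * y 0) := by ring
      have e2 : -((p : ℚ_[p]) ^ k * q 1) * q 0 + (p : ℚ_[p]) ^ k * q 0 * q 1 = 0 := by ring
      change 0 < δ * ‖-((p : ℚ_[p]) ^ k * q 1) * y 0 + (p : ℚ_[p]) ^ k * q 0 * y 1‖ -
        ‖-((p : ℚ_[p]) ^ k * q 1) * q 0 + (p : ℚ_[p]) ^ k * q 0 * q 1‖
      rw [e1, e2, norm_zero, sub_zero]
      exact mul_pos hδ (norm_pos_iff.2 (mul_ne_zero hp0 hdet))⟩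
  exact ⟨a, b, by simpa [f] using hab⟩

theorem not_forall_mem_PBadEps {M : Matrix (Fin 2) (Fin 2) ℤ} (hM : IsPositiveWordMatrix M)
    {q : Fin 2 → ℚ_[p]} (hq : q ≠ 0) (hMq : ¬ ∃ μ : ℚ_[p], padicLin p M q = μ • q)
    {ε : ℝ} (hε : 0 < ε) (hbad : ∀ k : ℕ, ∃ h : padicLin p (M ^ k) q ≠ 0,
      Projectivization.mk ℚ_[p] _ h ∈ PBadEps p ε) : False := by
  obtain ⟨m₀, hm₀, u₀, α₀, h₀, hu, hα⟩ :=
    exists_pow_eq_dvd hM.isUnit_det (pow_pos hp.out.pos 2 : 0 < p ^ 2)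
  push_cast at hu hα
  -- Otherwise `M ^ m₀` would be scalar, yet its off-diagonal entries are positive.
  have hu₀ : u₀ ≠ 0 := by
    rintro rfl
    have h := (hM.pow hm₀).zero_one
    rw [h₀, Matrix.add_apply, Matrix.smul_apply, Matrix.smul_apply] at h
    simp at h
  have hu₀' : 0 < ‖(u₀ : ℚ_[p])‖ := norm_pos_iff.2 (by exact_mod_cast hu₀)
  obtain ⟨a, b, hab⟩ := exists_int_norm_le hq hMq hu₀'
  let φ : (Fin 2 → ℚ_[p]) →ₗ[ℚ_[p]] ℚ_[p] :=
    (a : ℚ_[p]) • LinearMap.proj 0 + (b : ℚ_[p]) • LinearMap.proj 1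
  have hφ : ∀ x, φ x = (a : ℚ_[p]) * x 0 + b * x 1 := fun x => by simp [φ]
  simp only [← hφ] at hab
  set β := ‖φ (padicLin p M q)‖ with hβ
  have hβ0 : 0 < β := pos_of_mul_pos_right ((norm_nonneg _).trans_lt hab) hu₀'.le
  have hne : (a, b) ≠ (0, 0) := by
    intro h
    simp only [Prod.mk.injEq] at h
    simp [hβ, hφ, h.1, h.2] at hβ0
  set m : ℝ := max |(a : ℝ)| |(b : ℝ)| with hm
  have hm0 : 0 < m := by
    rw [hm, lt_max_iff, abs_pos, abs_pos]
    by_contra! h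
    exact hne (by simpa using h)
  obtain ⟨j, hj⟩ : ∃ j : ℕ, (p : ℝ)⁻¹ ^ j < ε / m ^ 2 :=
    exists_pow_lt_of_lt_one (by positivity)
      (inv_lt_one_of_one_lt₀ (by exact_mod_cast hp.out.one_lt))
  obtain ⟨k, hk, hb⟩ := exists_pow_norm_le h₀ hu hu₀
    ((dvd_pow_self _ two_ne_zero).trans hα) φ (norm_pos_iff.1 hβ0) hab.le j
  obtain ⟨hx, hxb⟩ := hbad k
  set x := padicLin p (M ^ k) q
  -- `φ` and `M` have integer coefficients, so the constant norm of `φ (M x)` keeps the denominator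
  -- away from zero while `φ x` shrinks.
  have hmax : β ≤ max ‖x 0‖ ‖x 1‖ := by
    rw [hβ, ← hb, hφ, padicLin_apply, padicLin_apply]
    have h0 := le_max_left ‖x 0‖ ‖x 1‖
    have h1 := le_max_right ‖x 0‖ ‖x 1‖
    refine norm_add_le_of_le (norm_intCast_mul_le _ (norm_add_le_of_le ?_ ?_))
      (norm_intCast_mul_le _ (norm_add_le_of_le ?_ ?_)) <;>
      exact norm_intCast_mul_le _ (by assumption)
  have h := hxb x hx rfl a b hne
  rw [← hφ, ← hm, le_div_iff₀ (hβ0.trans_le hmax)] at h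
  have : (p : ℝ)⁻¹ ^ j * ‖(u₀ : ℚ_[p])‖ * β ≤ (p : ℝ)⁻¹ ^ j * β := by
    gcongr
    exact mul_le_of_le_one_right (by positivity) (Padic.norm_int_le_one _)
  have : (p : ℝ)⁻¹ ^ j * β < ε / m ^ 2 * β := by gcongr
  have : ε / m ^ 2 * β ≤ ε / m ^ 2 * max ‖x 0‖ ‖x 1‖ := by gcongr
  linarith

/-! ### The characterization for periodic words -/

theorem words_mono {N N' : ℕ} (h : N ≤ N') : words N ⊆ words N' :=
  fun _ hw n => ⟨(hw n).1, (hw n).2.trans h⟩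

theorem shift_mem_words {N : ℕ} {w : ℕ → ℕ} (hw : w ∈ words N) (r : ℕ) :
    (fun i => w (i + r)) ∈ words N := fun n => hw (n + r)

theorem mem_LMad_iff_isEigenpoint {N : ℕ} {w : ℕ → ℕ} (hw : w ∈ words N) {l : ℕ} (hl : 0 < l)
    (hper : Function.Periodic w l) (x : P1 p) :
    (w, x) ∈ LMad p ↔ IsEigenpoint p (wordMatrix (wordPrefix w l))ᵀ x := by
  constructor
  · rintro ⟨ε, hε, h⟩
    induction x using Projectivization.ind with | h q hq
    rw [isEigenpoint_mk_iff]
    by_contra hM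
    refine not_forall_mem_PBadEps (isPositiveWordMatrix_wordPrefix hw hl).transpose hq hM hε
      fun k => ?_
    obtain ⟨hk, e⟩ := iterate_T_mul hper q hq k
    have := h (l * k)
    rw [e] at this
    exact ⟨hk, this.2⟩
  · intro hx
    have hT := (isPeriodicPt_T_iff hper x).2 hx
    have hfst : ∀ r, ((T p)^[r] (w, x)).1 = fun i => w (i + r) := fun r => by
      induction x using Projectivization.ind with | h q hq
      obtain ⟨_, e⟩ := iterate_T w q hq r
      rw [e]
    have hε : ∀ r, ∃ ε : ℝ, 0 < ε ∧ ((T p)^[r] (w, x)).2 ∈ PBadEps p ε := fun r => by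
      have hper' : Function.Periodic (fun i => w (i + r)) l := fun i => by
        simpa only [add_right_comm] using hper (i + r)
      have hTr : Function.IsPeriodicPt (T p) l
          (fun i => w (i + r), ((T p)^[r] (w, x)).2) := by
        rw [← hfst r]
        exact hT.apply_iterate r
      exact exists_mem_PBadEps_of_isEigenpoint
        (isPositiveWordMatrix_wordPrefix (shift_mem_words hw r) hl).transpose.anisotropic
        ((isPeriodicPt_T_iff hper' _).1 hTr)
    choose ε hε0 hεx using hε
    -- The orbit has at most `l` points, so a minimum over one period suffices.
    obtain ⟨δ, hδ0, hδ⟩ : ∃ δ : ℝ, 0 < δ ∧ ∀ r < l, δ ≤ ε r := by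
      refine ⟨(Finset.range l).inf' (Finset.nonempty_range_iff.2 hl.ne') ε, ?_, fun r hr =>
        Finset.inf'_le _ (Finset.mem_range.2 hr)⟩
      rw [Finset.lt_inf'_iff]
      exact fun r _ => hε0 r
    have hN : (0 : ℝ) < N + 1 := by positivity
    -- The second term makes the alphabet attached to `ε` contain `{1, …, N}`.
    refine ⟨min δ (N + 1 : ℝ)⁻¹, by positivity, fun n => ⟨?_, ?_⟩⟩
    · rw [hfst]
      refine words_mono ?_ (shift_mem_words hw n)
      refine (Nat.le_floor ?_).trans (Nat.le_succ _)
      refine (lt_add_one (N : ℝ)).le.trans ?_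
      rw [le_inv_comm₀ hN (by positivity)]
      exact min_le_right _ _
    · rw [← hT.iterate_mod_apply n]
      exact PBadEps_anti ((min_le_left _ _).trans (hδ _ (Nat.mod_lt _ hl))) (hεx _)

/-! ### Infinitude -/

/-- The constant words with letters divisible by `8 p` have `p`-adic eigenpoints. -/
theorem exists_isEigenpoint_letterMatrix (a : ℕ) (ha : 8 * p ∣ a) :
    ∃ x : P1 p, IsEigenpoint p (letterMatrix a) x := by
  obtain ⟨c, rfl⟩ := ha
  have hp1 : (p : ℝ)⁻¹ < 1 := inv_lt_one_of_one_lt₀ (by exact_mod_cast hp.out.one_lt)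
  have h2 : 0 < ‖(2 : ℤ_[p])‖ := norm_pos_iff.2 two_ne_zero
  have h2' : ‖(2 : ℤ_[p])‖ ≤ 1 := PadicInt.norm_le_one _
  -- This is Hensel's condition at 1 for `X² - aX - 1`, whose value there is `-a` and whose
  -- derivative has norm `‖2‖`. The extra powers of 2 cover `p = 2`.
  have hlt : ‖((8 * p * c : ℕ) : ℤ_[p])‖ < ‖(2 : ℤ_[p])‖ ^ 2 := by
    have : ((8 * p * c : ℕ) : ℤ_[p]) = 2 ^ 2 * (p * (2 * c)) := by push_cast; ring
    rw [this, norm_mul, norm_pow]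
    refine mul_lt_of_lt_one_right (by positivity) ?_
    rw [norm_mul, PadicInt.norm_p]
    exact (mul_le_of_le_one_right (by positivity) (PadicInt.norm_le_one _)).trans_lt hp1
  generalize 8 * p * c = a at hlt ⊢
  have hd : ‖(2 : ℤ_[p]) - a‖ = ‖(2 : ℤ_[p])‖ := by
    have h : ‖-(a : ℤ_[p])‖ < ‖(2 : ℤ_[p])‖ := by
      rw [norm_neg]
      exact hlt.trans_le (pow_le_of_le_one h2.le h2' two_ne_zero)
    rw [sub_eq_add_neg, PadicInt.norm_add_eq_max_of_ne h.ne', max_eq_left h.le]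
  let F : Polynomial ℤ_[p] := Polynomial.X ^ 2 - Polynomial.C (a : ℤ_[p]) * Polynomial.X - 1
  obtain ⟨z, hz, -⟩ := hensels_lemma (p := p) (F := F) (a := (1 : ℤ_[p])) (by
    have h1 : F.aeval (1 : ℤ_[p]) = -(a : ℤ_[p]) := by simp [F]
    have h3 : F.derivative.aeval (1 : ℤ_[p]) = 2 - a := by simp [F, one_add_one_eq_two]
    rw [h1, h3, norm_neg, hd]
    exact hlt)
  have hz' : (z : ℚ_[p]) ^ 2 - a * z - 1 = 0 := by
    have : z ^ 2 - a * z - 1 = 0 := by simpa [F] using hz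
    exact_mod_cast congrArg (fun x : ℤ_[p] => (x : ℚ_[p])) this
  have hv : (![1, (z : ℚ_[p])] : Fin 2 → ℚ_[p]) ≠ 0 := fun h => by
    simpa using congrFun h 0
  refine ⟨Projectivization.mk ℚ_[p] _ hv, (isEigenpoint_mk_iff hv).2 ⟨z, ?_⟩⟩
  refine funext (Fin.forall_fin_two.2 ⟨?_, ?_⟩)
  · simp [padicLin_apply, letterMatrix]
  · simp only [padicLin_apply, letterMatrix]
    simp
    linear_combination -hz'

theorem infinite_LMad : (LMad p).Infinite := by
  choose x hx using fun k : ℕ =>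
    exists_isEigenpoint_letterMatrix (p := p) (8 * p * (k + 1)) (Dvd.intro _ rfl)
  have hp0 := hp.out.pos
  refine Set.infinite_of_injective_forall_mem
    (f := fun k : ℕ => ((fun _ => 8 * p * (k + 1) : ℕ → ℕ), x k)) ?_ fun k => ?_
  · intro k k' h
    have h1 := congrFun (Prod.mk.inj h).1 0
    simpa [hp0.ne'] using h1
  · have hw : (fun _ => 8 * p * (k + 1) : ℕ → ℕ) ∈ words (8 * p * (k + 1)) :=
      fun _ => ⟨Nat.mul_pos (Nat.mul_pos (by decide) hp0) k.succ_pos, le_rfl⟩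
    refine (mem_LMad_iff_isEigenpoint hw one_pos (fun _ => rfl) _).2 ?_
    have : (wordMatrix (wordPrefix (fun _ => 8 * p * (k + 1)) 1))ᵀ =
        letterMatrix (8 * p * (k + 1)) := by
      ext i j
      fin_cases i <;> fin_cases j <;> simp [wordMatrix, wordPrefix, letterMatrix]
    rw [this]
    exact hx k

end PLC

end

theorem theorem2p2 (p : ℕ) [Fact p.Prime] :
    (∀ (N : ℕ) (w : ℕ → ℕ), w ∈ PLC.words N →
      ∀ l : ℕ, IsLeast {k : ℕ | 0 < k ∧ Function.Periodic w k} l →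
        ∀ x : PLC.P1 p, (w, x) ∈ PLC.LMad p ↔
          PLC.IsEigenpoint p (PLC.wordMatrix (PLC.wordPrefix w l)).transpose x) ∧
    (PLC.LMad p).Infinite :=
  ⟨fun _ _ hw _ hl x => PLC.mem_LMad_iff_isEigenpoint hw hl.1.1 hl.1.2 x, PLC.infinite_LMad⟩
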